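/- Let $\mathcal P$ be a finite set of processes and let $\widetilde\Sigma=\{\Sigma_i\}_{i\in\mathcal P}$ be a distributed alphabet whose set of letters $\Sigma=\bigcup_{i\in\mathcal P}\Sigma_i$ is finite and non-empty. For $a\in\Sigma$ put $\mathrm{loc}(a)=\{i\mid a\in\Sigma_i\}$; letters $a,b$ are dependent if $\mathrm{loc}(a)\cap\mathrm{loc}(b)\neq\emptyset$. A trace over $\widetilde\Sigma$ is (the isomorphism class of) a finite $\Sigma$-labelled poset $t=(E,\le,\lambda)$ in which $e\lessdot e'$ implies that $\lambda(e),\lambda(e')$ are dependent, and in which any two events with dependent labels are comparable. A trace language is a set of traces over $\widetilde\Sigma$. Let $E_i=\{e\in E\mid \lambda(e)\in\Sigma_i\}$. **Logic.** The formulas of $\mathsf{LocTL}[\mathsf Y_i,\mathsf S_i]$ are the trace formulas $\beta ::= \exists_i\,\alpha\mid\neg\beta\mid\beta\vee\beta$, built over the event formulas $\alpha ::= a\mid\neg\alpha\mid\alpha\vee\alpha\mid\mathsf Y_i\,\alpha\mid\alpha\,\mathsf S_i\,\alpha$ ($a\in\Sigma$, $i\in\mathcal P$). For an event $e$ of $t$: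 $t,e\models a$ iff $\lambda(e)=a$; $t,e\models\mathsf Y_i\alpha$ iff there is a maximal element $e_i$ of $\{f\in E_i\mid f<e\}$ and $t,e_i\models\alpha$; $t,e\models\alpha\,\mathsf S_i\,\alpha'$ iff $e\in E_i$ and there is $f\in E_i$ with $f<e$, $t,f\models\alpha'$, and $t,g\models\alpha$ for all $g\in E_i$ with $f<g<e$; $t\models\exists_i\alpha$ iff $E_i$ has a maximal event $e$ and $t,e\models\alpha$; Boolean connectives are as usual. The formula $\beta$ defines the language $\{t\mid t\models\beta\}$. **Automata.** An asynchronous automaton over $\widetilde\Sigma$ has a finite non-empty set $S_i$ of local states for each process $i$, a map $\delta_a:\prod_{i\in\mathrm{loc}(a)}S_i\to\prod_{i\in\mathrm{loc}(a)}S_i$ for each letter $a$, and an initial global state in $\prod_{i\in\mathcal P}S_i$. Let $\Delta_a$ be the extension of $\delta_a$ to global states that fixes the other components. The run on a trace $t$ is the unique map $\rho_t$ from the downward closed subsets (configurations) of $E$ to global states such that $\rho_t(\emptyset)$ is the initial state and $\rho_t(c\cup\{e\})=\Delta_{\lambda(e)}(\rho_t(c))$ whenever $c$ and $c\cup\{e\}$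 are configurations and $e\notin c$. For a process $\ell$, $U_2[\ell]$ denotes any asynchronous automaton such that $S_\ell=\{1,2\}$, $S_i$ is a singleton for $i\ne\ell$, and there are disjoint $R_1,R_2\subseteq\Sigma_\ell$ such that letters of $R_1$ (resp. $R_2$) reset the state of $\ell$ to $1$ (resp. $2$) and all other letters leave the state unchanged. **Global cascade products.** A global cascade product over $\widetilde\Sigma$ is either a single asynchronous automaton over $\widetilde\Sigma$ or a product $B_1\circ_g B_2$, where $B_1$ is a global cascade product over $\widetilde\Sigma$ with set of global states $G_1$ and $B_2$ is a global cascade product over the alphabet $\Sigma\times G_1$ distributed by $\mathrm{loc}(a,s)=\mathrm{loc}(a)$. The run of $B_1\circ_g B_2$ on $t$ is $c\mapsto(\rho^1(c),\rho^2(c))$, where $\rho^1$ is the run of $B_1$ on $t$ and $\rho^2$ is the run of $B_2$ on the trace obtained from $t$ by relabelling each event $e$ with $(\lambda(e),\rho^1(\{f\mid f<e\}))$. It accepts a language $L$ if, for some set $F$ of global states, $L$ is the set of traces $t$ whose run maps the full configuration $E$ into $F$. **Theorem.** A trace language over $\widetilde\Sigma$ is defined by a $\mathsf{LocTL}[\mathsf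 Y_i,\mathsf S_i]$ formula if and only if it is accepted by a global cascade product (of one or more factors) of automata each of which is of the form $U_2[\ell]$, where the process $\ell\in\mathcal P$ may vary from factor to factor. -/

import Mathlib

universe u

namespace TraceCascade

/-! ### Distributed alphabets and traces -/

/-- A distributed alphabet over the processes `P`: a family of subsets `sub i` (`i : P`) whose
union is the set `A` of all letters. -/
structure DistAlphabet (P A : Type u) where
  sub : P → Set A
  cover : ∀ a, ∃ i, a ∈ sub i

namespace DistAlphabet

variable {P A : Type u}

/-- The processes participating in the letter `a`. -/
def loc (D : DistAlphabet P A) (a : A) : Set P := {i | a ∈ D.sub i}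

/-- The dependence relation. -/
def Dep (D : DistAlphabet P A) (a b : A) : Prop := (D.loc a ∩ D.loc b).Nonempty

/-- The distributed alphabet on `A × G` in which `(a, g)` has the same processes as `a`. -/
def extend (D : DistAlphabet P A) (G : Type u) : DistAlphabet P (A × G) where
  sub i := {x | x.1 ∈ D.sub i}
  cover x := D.cover x.1

end DistAlphabet

/-- A trace over a distributed alphabet, as a concrete finite labelled poset. -/
structure Trace {P A : Type u} (D : DistAlphabet P A) where
  E : Type
  [finite : Finite E]
  [order : PartialOrder E]
  lab : E → A
  dep_of_covBy : ∀ e e' : E, e ⋖ e' → D.Dep (lab e) (lab e')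
  le_total_of_dep : ∀ e e' : E, D.Dep (lab e) (lab e') → e ≤ e' ∨ e' ≤ e

attribute [instance] Trace.finite Trace.order

namespace Trace

variable {P A : Type u} {D : DistAlphabet P A}

/-- The set of `i`-events of `t`. -/
def events (t : Trace D) (i : P) : Set t.E := {e | t.lab e ∈ D.sub i}

/-- The trace with the same poset as `t` in which every event `e` is additionally labelled with
the value of `ρ` at the configuration of all events strictly below `e`. -/
def relabel {G : Type u} (t : Trace D) (ρ : LowerSet t.E → G) : Trace (D.extend G) where
  E := t.E
  lab e := (t.lab e, ρ (LowerSet.Iio e))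
  dep_of_covBy := t.dep_of_covBy
  le_total_of_dep := t.le_total_of_dep

/-- Isomorphism of labelled posets. -/
def Iso (t t' : Trace D) : Prop := ∃ f : t.E ≃o t'.E, ∀ e, t'.lab (f e) = t.lab e

/-- Traces are identified when they are isomorphic. -/
def isoSetoid (D : DistAlphabet P A) : Setoid (Trace D) where
  r := Iso
  iseqv :=
    { refl := fun t => ⟨OrderIso.refl _, fun _ => rfl⟩
      symm := fun ⟨f, hf⟩ => ⟨f.symm, fun e => by rw [← hf, OrderIso.apply_symm_apply]⟩
      trans := fun ⟨f, hf⟩ ⟨g, hg⟩ =>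
        ⟨f.trans g, fun e => by rw [OrderIso.trans_apply, hg, hf]⟩ }

end Trace

/-- The set of all traces over `D`, up to isomorphism of labelled posets. -/
def TR {P A : Type u} (D : DistAlphabet P A) : Type (max u 1) := Quotient (Trace.isoSetoid D)

/-- The element of `TR D` represented by a labelled poset. -/
def Trace.toTR {P A : Type u} {D : DistAlphabet P A} (t : Trace D) : TR D :=
  Quotient.mk (Trace.isoSetoid D) t

/-! ### Asynchronous automata -/

/-- A (deterministic) asynchronous automaton: the transition of a letter `a` reads and updates
only the local states of the processes in `loc a`. -/
structure AsyncAutomaton {P A : Type u} (D : DistAlphabet P A) where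
  S : P → Type u
  [finite : ∀ i, Finite (S i)]
  δ : (a : A) → ((i : D.loc a) → S i) → ((i : D.loc a) → S i)
  init : (i : P) → S i

namespace AsyncAutomaton

variable {P A : Type u} {D : DistAlphabet P A}

/-- Global states. -/
abbrev Global (M : AsyncAutomaton D) : Type u := (i : P) → M.S i

open Classical in
/-- The extension of `δ a` to global states. -/
noncomputable def Δ (M : AsyncAutomaton D) (a : A) (s : M.Global) : M.Global :=
  fun i => if h : i ∈ D.loc a then M.δ a (fun j => s j) ⟨i, h⟩ else s i

/-- `ρ` is the trace run of `M` on `t`. Configurations of `t` are the lower sets of events. -/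
def IsRun (M : AsyncAutomaton D) (t : Trace D) (ρ : LowerSet t.E → M.Global) : Prop :=
  ρ ⊥ = M.init ∧
    ∀ (c c' : LowerSet t.E) (e : t.E), e ∉ c → (c' : Set t.E) = insert e (c : Set t.E) →
      ρ c' = M.Δ (t.lab e) (ρ c)

/-- `M` is a two-state reset automaton `U₂[l]` localized at the process `l`: process `l` has
exactly two local states `q₁ ≠ q₂`, every other process has exactly one, and there are two
disjoint sets `R₁, R₂` of letters of process `l` that reset the state of `l` to `q₁` and `q₂`
respectively, while all other letters leave the state unchanged. -/
def IsU2 (M : AsyncAutomaton D) (l : P) : Prop :=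
  (∀ i, i ≠ l → Nat.card (M.S i) = 1) ∧
  ∃ q₁ q₂ : M.S l, q₁ ≠ q₂ ∧ (∀ q, q = q₁ ∨ q = q₂) ∧
    ∃ R₁ R₂ : Set A, R₁ ⊆ D.sub l ∧ R₂ ⊆ D.sub l ∧ Disjoint R₁ R₂ ∧
      ∀ (a : A) (s : M.Global),
        (a ∈ R₁ → M.Δ a s l = q₁) ∧
        (a ∈ R₂ → M.Δ a s l = q₂) ∧
        (a ∉ R₁ → a ∉ R₂ → M.Δ a s l = s l)

end AsyncAutomaton

/-! ### Global cascade products -/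

/-- Global cascade products over `D` with set of global states `G`: a single asynchronous
automaton, or the product of a global cascade product `B₁` over `D` and a global cascade product
`B₂` over the alphabet extended by the global states of `B₁`. -/
inductive GlobalCascade {P : Type u} :
    {A : Type u} → DistAlphabet P A → Type u → Type (u + 1)
  | base {A : Type u} {D : DistAlphabet P A} (M : AsyncAutomaton D) : GlobalCascade D M.Global
  | prod {A : Type u} {D : DistAlphabet P A} {G₁ G₂ : Type u}
      (B₁ : GlobalCascade D G₁) (B₂ : GlobalCascade (D.extend G₁) G₂) :
      GlobalCascade D (G₁ × G₂)

namespace GlobalCascade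

variable {P : Type u}

/-- `ρ` is the run of the cascade on `t`. A run of the product of `B₁` and `B₂` on `t` consists of
a run `ρ₁` of `B₁` on `t` and a run of `B₂` on the output of the global asynchronous transducer of
`B₁` on `t`, in which each event `e` is additionally labelled by the global state reached by `B₁`
at the strict past of `e`. -/
def IsRun : {A : Type u} → {D : DistAlphabet P A} → {G : Type u} → GlobalCascade D G →
    (t : Trace D) → (LowerSet t.E → G) → Prop
  | _, _, _, base M, t, ρ => M.IsRun t ρ
  | _, _, _, prod B₁ B₂, t, ρ =>
      IsRun B₁ t (fun c => (ρ c).1) ∧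
        IsRun B₂ (t.relabel (fun c => (ρ c).1)) (fun c : LowerSet t.E => (ρ c).2)

/-- Every automaton in the cascade is a localized two-state reset automaton `U₂[l]`, for some
process `l` that may vary along the cascade. -/
def IsU2Cascade : {A : Type u} → {D : DistAlphabet P A} → {G : Type u} →
    GlobalCascade D G → Prop
  | _, _, _, base M => ∃ l, M.IsU2 l
  | _, _, _, prod B₁ B₂ => IsU2Cascade B₁ ∧ IsU2Cascade B₂

/-- `L` is accepted by the cascade with some set `F` of final global states: `t` belongs to `L`
if and only if the run on `t` ends in `F`. -/
def Accepts {A : Type u} {D : DistAlphabet P A} {G : Type u} (B : GlobalCascade D G)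
    (L : Set (TR D)) : Prop :=
  ∃ F : Set G, ∀ t : Trace D, t.toTR ∈ L ↔ ∃ ρ, B.IsRun t ρ ∧ ρ ⊤ ∈ F

end GlobalCascade

/-! ### The past local temporal logic `LocTL[Y_i, S_i]` -/

/-- Event formulas. -/
inductive EventFormula (P A : Type u) : Type u
  | letter (a : A) : EventFormula P A
  | neg (α : EventFormula P A) : EventFormula P A
  | or (α β : EventFormula P A) : EventFormula P A
  | Y (i : P) (α : EventFormula P A) : EventFormula P A
  | since (i : P) (α β : EventFormula P A) : EventFormula P A

/-- Trace formulas. -/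
inductive TraceFormula (P A : Type u) : Type u
  | ex (i : P) (α : EventFormula P A) : TraceFormula P A
  | neg (β : TraceFormula P A) : TraceFormula P A
  | or (β γ : TraceFormula P A) : TraceFormula P A

/-- Satisfaction of an event formula at an event. -/
def EventFormula.Sat {P A : Type u} {D : DistAlphabet P A} (t : Trace D) :
    t.E → EventFormula P A → Prop
  | e, .letter a => t.lab e = a
  | e, .neg α => ¬ Sat t e α
  | e, .or α β => Sat t e α ∨ Sat t e β
  | e, .Y i α => ∃ f, Maximal (fun x => x < e ∧ x ∈ t.events i) f ∧ Sat t f α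
  | e, .since i α β => e ∈ t.events i ∧ ∃ f ∈ t.events i, f < e ∧ Sat t f β ∧
      ∀ g ∈ t.events i, f < g → g < e → Sat t g α

/-- Satisfaction of a trace formula in a trace. -/
def TraceFormula.Sat {P A : Type u} {D : DistAlphabet P A} (t : Trace D) :
    TraceFormula P A → Prop
  | .ex i α => ∃ e, Maximal (fun x => x ∈ t.events i) e ∧ EventFormula.Sat t e α
  | .neg β => ¬ Sat t β
  | .or β γ => Sat t β ∨ Sat t γ

/-- `β` defines the trace language `L`. -/
def TraceFormula.Defines {P A : Type u} {D : DistAlphabet P A} (β : TraceFormula P A)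
    (L : Set (TR D)) : Prop :=
  ∀ t : Trace D, t.toTR ∈ L ↔ β.Sat t

end TraceCascade

/-!
The local state of a reset automaton `U₂[l]` at a configuration `c` only depends on the last
resetting event of `c`: the state is `q₂` when some event of `R₂` in `c` is followed by no event of
`R₁` in `c`, or when the initial state is `q₂` and `c` has no event of `R₁`. This is the predicate
`ResetOn`. Since `l`-events are totally ordered, it obeys the recursion that defines runs
(`resetOn_iff_of_eq_insert`), which gives both the existence of runs and their description. On the
logical side such a condition is exactly what `Y_l` and `S_l` express.

*From formulas to cascades.* A cascade determines an event formula `α` if the truth of `α` at an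
event `e` is a function of the letter of `e` and of the global state at the strict past of `e`. By
induction on `α`, every cascade can be prolonged so as to determine `α`. For `Y_l α`, one appends a
`U₂[l]` which records whether the last `l`-event satisfies `α`; for `α S_l β`, one which is set by
`β` and cleared by `¬ β ∧ ¬ α`. All these automata act on letters extended by the global state of
the preceding ones, so the truth of `α` and `β` at the current event can be read off its letter.

*From cascades to formulas.* By induction on the cascade, for every global state `g` there are an
event formula saying that the state at the strict past of the current event is `g`, and a trace
formula saying that the final state is `g` (`GlobalCascade.exists_stateFormulas`). For a single
`U₂[l]` these formulas express `ResetOn`. In a product, the formulas for the second factor use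
letters `(a, g)`, which are replaced by the conjunction of `a` and the formula for the state `g` of
the first factor.
-/

namespace TraceCascade

/-! ### Configurations and reset events -/

/-- Every lower set of a finite partial order is built from the empty one by adding one element at
a time. -/
theorem lowerSet_induction {E : Type*} [Finite E] [PartialOrder E] {p : LowerSet E → Prop}
    (bot : p ⊥)
    (insert : ∀ (c c' : LowerSet E) (e : E), e ∉ c → (c' : Set E) = insert e (c : Set E) →
      p c → p c') (c : LowerSet E) : p c := by
  have : Finite (LowerSet E) := Finite.of_injective _ SetLike.coe_injective
  induction c using WellFoundedLT.induction with
  | ind c ih =>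
    rcases (c : Set E).eq_empty_or_nonempty with h | h
    · have : c = ⊥ := SetLike.coe_injective (by simpa using h)
      exact this ▸ bot
    · obtain ⟨e, he⟩ := (Set.toFinite (c : Set E)).exists_maximal h
      have hmem : ∀ x, x ∈ c.erase e ↔ x ∈ c ∧ x ≠ e := by
        intro x
        rw [← SetLike.mem_coe, LowerSet.coe_erase]
        simp only [Set.mem_sdiff, SetLike.mem_coe, UpperSet.coe_Ici, Set.mem_Ici]
        refine and_congr_right fun hx => not_congr ⟨fun h => ?_, fun h => h.ge⟩
        exact le_antisymm (he.2 hx h) h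
      refine insert (c.erase e) c e (fun h => ((hmem e).1 h).2 rfl) ?_ (ih _ ?_)
      · ext x
        simp only [Set.mem_insert_iff, SetLike.mem_coe, hmem]
        by_cases hx : x = e
        · simpa [hx] using he.1
        · simp [hx]
      · exact LowerSet.erase_lt.2 he.1

variable {P A : Type u} {D : DistAlphabet P A}

/-- Two `l`-events of a trace are comparable. -/
theorem Trace.le_total_of_mem_sub (t : Trace D) {l : P} {e f : t.E} (he : t.lab e ∈ D.sub l)
    (hf : t.lab f ∈ D.sub l) : e ≤ f ∨ f ≤ e :=
  t.le_total_of_dep e f ⟨l, he, hf⟩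

/-- The condition for a two-state device to be on at the configuration `c`, if it is switched on by
the letters of `R₂`, switched off by the letters of `R₁`, and initially on if and only if `b`. -/
def ResetOn (t : Trace D) (R₁ R₂ : Set A) (b : Prop) (c : LowerSet t.E) : Prop :=
  (∃ f ∈ c, t.lab f ∈ R₂ ∧ ∀ g ∈ c, f < g → t.lab g ∉ R₁) ∨ (b ∧ ∀ g ∈ c, t.lab g ∉ R₁)

theorem resetOn_bot (t : Trace D) (R₁ R₂ : Set A) (b : Prop) : ResetOn t R₁ R₂ b ⊥ ↔ b := by
  simp [ResetOn]

theorem resetOn_iff_of_eq_insert (t : Trace D) {l : P} {R₁ R₂ : Set A} (b : Prop)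
    (h₁ : R₁ ⊆ D.sub l) (h₂ : R₂ ⊆ D.sub l) {c c' : LowerSet t.E} {e : t.E}
    (he : e ∉ c) (hc : (c' : Set t.E) = insert e (c : Set t.E)) :
    ResetOn t R₁ R₂ b c' ↔ t.lab e ∈ R₂ ∨ (t.lab e ∉ R₁ ∧ ResetOn t R₁ R₂ b c) := by
  have hmem : ∀ x, x ∈ c' ↔ x = e ∨ x ∈ c := fun x => by
    rw [← SetLike.mem_coe, hc]; rfl
  have hnlt : ∀ x ∈ c', ¬ e < x := fun x hx hlt =>
    ((hmem x).1 hx).elim (fun h => hlt.ne' h) fun h => he (c.lower hlt.le h)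
  have hnl : ∀ x ∈ c, ¬ e ≤ x := fun x hx hle => he (c.lower hle hx)
  by_cases hR₂ : t.lab e ∈ R₂
  · simp only [hR₂, true_or, iff_true]
    exact Or.inl ⟨e, (hmem e).2 (Or.inl rfl), hR₂, fun g hg hlt => absurd hlt (hnlt g hg)⟩
  by_cases hR₁ : t.lab e ∈ R₁
  · simp only [hR₂, hR₁, not_true, false_and, or_false, iff_false]
    rintro (⟨f, hf, hfR, hg⟩ | ⟨-, hg⟩)
    · rcases (hmem f).1 hf with rfl | hf
      · exact hR₂ hfR
      · rcases t.le_total_of_mem_sub (h₂ hfR) (h₁ hR₁) with h | h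
        · exact hg e ((hmem e).2 (Or.inl rfl)) (lt_of_le_of_ne h fun h => he (h ▸ hf)) hR₁
        · exact hnl f hf h
    · exact hg e ((hmem e).2 (Or.inl rfl)) hR₁
  · simp only [hR₂, hR₁, not_false_eq_true, true_and, false_or]
    unfold ResetOn
    simp only [hmem, or_and_right, exists_or, forall_eq_or_imp, exists_eq_left, hR₂, hR₁,
      not_false_eq_true, implies_true, true_and, false_and, false_or]

/-! ### Runs of reset automata and of cascades -/

namespace AsyncAutomaton

theorem IsRun.state_eq_iff_resetOn {M : AsyncAutomaton D} {t : Trace D}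
    {ρ : LowerSet t.E → M.Global} (hρ : M.IsRun t ρ) {l : P} {q₁ q₂ : M.S l} (hq : q₁ ≠ q₂)
    {R₁ R₂ : Set A} (h₁ : R₁ ⊆ D.sub l) (h₂ : R₂ ⊆ D.sub l)
    (hΔ : ∀ (a : A) (s : M.Global), (a ∈ R₁ → M.Δ a s l = q₁) ∧ (a ∈ R₂ → M.Δ a s l = q₂) ∧
      (a ∉ R₁ → a ∉ R₂ → M.Δ a s l = s l)) (c : LowerSet t.E) :
    ρ c l = q₂ ↔ ResetOn t R₁ R₂ (M.init l = q₂) c := by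
  induction c using lowerSet_induction with
  | bot => rw [hρ.1, resetOn_bot]
  | insert c c' e he hc ih =>
    rw [resetOn_iff_of_eq_insert t _ h₁ h₂ he hc, hρ.2 c c' e he hc, ← ih]
    obtain ⟨hs₁, hs₂, hs⟩ := hΔ (t.lab e) (ρ c)
    by_cases hR₂ : t.lab e ∈ R₂
    · simp [hs₂ hR₂, hR₂]
    by_cases hR₁ : t.lab e ∈ R₁
    · simp [hs₁ hR₁, hR₁, hR₂, hq]
    · simp [hs hR₁ hR₂, hR₁, hR₂]

open Classical in
theorem IsU2.exists_isRun {M : AsyncAutomaton D} {l : P} (hM : M.IsU2 l) (t : Trace D) :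
    ∃ ρ, M.IsRun t ρ := by
  obtain ⟨hcard, q₁, q₂, hq, hall, R₁, R₂, h₁, h₂, -, hΔ⟩ := hM
  have hsub : ∀ i, i ≠ l → Subsingleton (M.S i) := fun i hi =>
    (Nat.card_eq_one_iff_unique.1 (hcard i hi)).1
  refine ⟨fun c => Function.update M.init l
    (if ResetOn t R₁ R₂ (M.init l = q₂) c then q₂ else q₁), ?_, ?_⟩
  · funext i
    by_cases hi : i = l
    · subst hi
      beta_reduce
      rw [Function.update_self, resetOn_bot]
      split_ifs with h
      · exact h.symm
      · exact ((hall _).resolve_right h).symm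
    · exact (hsub i hi).elim _ _
  · intro c c' e he hc
    funext i
    by_cases hi : i = l
    · subst hi
      beta_reduce
      rw [Function.update_self, resetOn_iff_of_eq_insert t _ h₁ h₂ he hc]
      obtain ⟨hs₁, hs₂, hs⟩ := hΔ (t.lab e) (Function.update M.init i
        (if ResetOn t R₁ R₂ (M.init i = q₂) c then q₂ else q₁))
      by_cases hR₂ : t.lab e ∈ R₂
      · simp [hs₂ hR₂, hR₂]
      by_cases hR₁ : t.lab e ∈ R₁
      · simp [hs₁ hR₁, hR₁, hR₂]
      · simp [hs hR₁ hR₂, hR₁, hR₂]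
    · exact (hsub i hi).elim _ _

end AsyncAutomaton

theorem GlobalCascade.IsU2Cascade.exists_isRun {G : Type u} {B : GlobalCascade D G}
    (hB : B.IsU2Cascade) (t : Trace D) : ∃ ρ, B.IsRun t ρ := by
  induction B with
  | base M =>
    obtain ⟨l, hl⟩ := hB
    exact hl.exists_isRun t
  | prod B₁ B₂ ih₁ ih₂ =>
    obtain ⟨ρ₁, h₁⟩ := ih₁ hB.1 t
    obtain ⟨ρ₂, h₂⟩ := ih₂ hB.2 (t.relabel ρ₁)
    exact ⟨fun c => (ρ₁ c, ρ₂ c), h₁, h₂⟩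

/-! ### Last events -/

/-- The last `l`-event of the configuration `c` exists and satisfies `α`. -/
def LastSat (t : Trace D) (l : P) (c : LowerSet t.E) (α : EventFormula P A) : Prop :=
  ∃ m, Maximal (fun x => x ∈ c ∧ x ∈ t.events l) m ∧ α.Sat t m

theorem EventFormula.sat_Y_iff (t : Trace D) (l : P) (α : EventFormula P A) (e : t.E) :
    (EventFormula.Y l α).Sat t e ↔ LastSat t l (LowerSet.Iio e) α := Iff.rfl

theorem TraceFormula.sat_ex_iff (t : Trace D) (l : P) (α : EventFormula P A) :
    (TraceFormula.ex l α).Sat t ↔ LastSat t l ⊤ α := by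
  simp [LastSat, TraceFormula.Sat]

theorem Trace.exists_last (t : Trace D) (l : P) (c : LowerSet t.E) {f : t.E} (hf : f ∈ c)
    (hfl : f ∈ t.events l) :
    ∃ m, Maximal (fun x => x ∈ c ∧ x ∈ t.events l) m ∧ f ≤ m := by
  obtain ⟨m, hm, h⟩ := (Set.toFinite {x | x ∈ c ∧ x ∈ t.events l}).exists_le_maximal
    (show f ∈ {x | x ∈ c ∧ x ∈ t.events l} from ⟨hf, hfl⟩)
  exact ⟨m, h, hm⟩

theorem Trace.le_last (t : Trace D) {l : P} {c : LowerSet t.E} {m x : t.E}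
    (hm : Maximal (fun x => x ∈ c ∧ x ∈ t.events l) m) (hx : x ∈ c) (hxl : x ∈ t.events l) :
    x ≤ m :=
  (t.le_total_of_mem_sub hxl hm.1.2).elim id fun h => hm.2 ⟨hx, hxl⟩ h

/-- The variant of `α S_l β` in which the current event is taken into account. -/
def EventFormula.sinceIncl (l : P) (α β : EventFormula P A) : EventFormula P A :=
  .or β (.neg (.or (.neg α) (.neg (.since l α β))))

theorem EventFormula.sat_sinceIncl_iff (t : Trace D) (l : P) (α β : EventFormula P A) (e : t.E) :
    (EventFormula.sinceIncl l α β).Sat t e ↔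
      β.Sat t e ∨ (α.Sat t e ∧ (EventFormula.since l α β).Sat t e) := by
  simp only [EventFormula.sinceIncl, EventFormula.Sat, not_or, not_not]

theorem lastSat_sinceIncl_iff (t : Trace D) (l : P) (c : LowerSet t.E)
    (α β : EventFormula P A) :
    LastSat t l c (.sinceIncl l α β) ↔
      ∃ f ∈ c, f ∈ t.events l ∧ β.Sat t f ∧
        ∀ g ∈ c, g ∈ t.events l → f < g → α.Sat t g := by
  constructor
  · rintro ⟨m, hm, hs⟩
    rcases (EventFormula.sat_sinceIncl_iff t l α β m).1 hs with h | ⟨hα, -, f, hf, hfm, hβ, hg⟩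
    · exact ⟨m, hm.1.1, hm.1.2, h, fun g hg hgl hlt =>
        absurd hlt (t.le_last hm hg hgl).not_gt⟩
    · refine ⟨f, c.lower hfm.le hm.1.1, hf, hβ, fun g hgc hgl hlt => ?_⟩
      rcases (t.le_last hm hgc hgl).eq_or_lt with rfl | h
      · exact hα
      · exact hg g hgl hlt h
  · rintro ⟨f, hf, hfl, hβ, hg⟩
    obtain ⟨m, hm, hfm⟩ := t.exists_last l c hf hfl
    refine ⟨m, hm, (EventFormula.sat_sinceIncl_iff t l α β m).2 ?_⟩
    rcases hfm.eq_or_lt with rfl | hlt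
    · exact Or.inl hβ
    · exact Or.inr ⟨hg m hm.1.1 hm.1.2 hlt, hm.1.2, f, hfl, hlt, hβ,
        fun g hgl h h' => hg g (c.lower h'.le hm.1.1) hgl h⟩

/-- Among the `l`-events of `c`, the last one satisfies `α` if and only if all of them do from some
point on. -/
theorem lastSat_iff_exists (t : Trace D) (l : P) (c : LowerSet t.E) (α : EventFormula P A) :
    LastSat t l c α ↔ ∃ f ∈ c, f ∈ t.events l ∧ α.Sat t f ∧
      ∀ g ∈ c, g ∈ t.events l → f < g → α.Sat t g := by
  rw [← lastSat_sinceIncl_iff]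
  refine exists_congr fun m => and_congr_right fun _ => ?_
  rw [EventFormula.sat_sinceIncl_iff]
  tauto

/-- In `α S_l β` the witness may be the last possible one, so `α` may be weakened to `α ∨ β`. -/
theorem EventFormula.sat_since_iff (t : Trace D) (l : P) (α β : EventFormula P A) (e : t.E) :
    (EventFormula.since l α β).Sat t e ↔ e ∈ t.events l ∧ ∃ f < e, f ∈ t.events l ∧ β.Sat t f ∧
      ∀ g < e, g ∈ t.events l → f < g → β.Sat t g ∨ α.Sat t g := by
  refine and_congr_right fun _ => ⟨?_, ?_⟩
  · rintro ⟨f, hfl, hfe, hβ, hg⟩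
    exact ⟨f, hfe, hfl, hβ, fun g hge hgl hfg => Or.inr (hg g hgl hfg hge)⟩
  · rintro ⟨f, hfe, hfl, hβ, hg⟩
    obtain ⟨m, hfm, hm⟩ := (Set.toFinite {x | x < e ∧ x ∈ t.events l ∧ β.Sat t x}).exists_le_maximal
      (show f ∈ {x | x < e ∧ x ∈ t.events l ∧ β.Sat t x} from ⟨hfe, hfl, hβ⟩)
    refine ⟨m, hm.1.2.1, hm.1.1, hm.1.2.2, fun g hgl hmg hge => ?_⟩
    refine (hg g hge hgl (hfm.trans_lt hmg)).resolve_left fun h => ?_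
    exact (hm.2 ⟨hge, hgl, h⟩ hmg.le).not_gt hmg

/-! ### From formulas to cascades -/

open Classical in
/-- The automaton `U₂[l]` with reset sets `R₁`, `R₂` and initial state off. The local states are
Booleans, constrained to be `false` at the processes other than `l`. -/
noncomputable def resetAutomaton (D : DistAlphabet P A) (l : P) (R₁ R₂ : Set A) :
    AsyncAutomaton D where
  S i := ULift {b : Bool // i ≠ l → b = false}
  δ a s i := ⟨⟨if (i : P) = l ∧ a ∈ R₂ then true else if a ∈ R₁ then false else (s i).down.1, by
    intro hi
    rw [if_neg fun h => hi h.1]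
    split_ifs
    · rfl
    · exact (s i).down.2 hi⟩⟩
  init _ := ⟨⟨false, fun _ => rfl⟩⟩

/-- The state of process `l` in which `resetAutomaton D l R₁ R₂` is on. -/
def resetAutomaton.on (D : DistAlphabet P A) (l : P) (R₁ R₂ : Set A) :
    (resetAutomaton D l R₁ R₂).S l := ULift.up ⟨true, fun h => absurd rfl h⟩

theorem resetAutomaton_Δ {l : P} {R₁ R₂ : Set A} (h₁ : R₁ ⊆ D.sub l) (h₂ : R₂ ⊆ D.sub l)
    (hd : Disjoint R₁ R₂) (a : A) (s : (resetAutomaton D l R₁ R₂).Global) :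
    (a ∈ R₁ → (resetAutomaton D l R₁ R₂).Δ a s l = (resetAutomaton D l R₁ R₂).init l) ∧
    (a ∈ R₂ → (resetAutomaton D l R₁ R₂).Δ a s l = resetAutomaton.on D l R₁ R₂) ∧
    (a ∉ R₁ → a ∉ R₂ → (resetAutomaton D l R₁ R₂).Δ a s l = s l) := by
  refine ⟨fun h => ?_, fun h => ?_, fun h h' => ?_⟩
  · have hl : l ∈ D.loc a := h₁ h
    have h' : a ∉ R₂ := Set.disjoint_left.1 hd h
    simp [AsyncAutomaton.Δ, hl, resetAutomaton, h, h']
  · have hl : l ∈ D.loc a := h₂ h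
    simp [AsyncAutomaton.Δ, hl, resetAutomaton, resetAutomaton.on, h]
  · unfold AsyncAutomaton.Δ
    split_ifs
    · simp only [resetAutomaton, h, h', and_false, if_false]
      rfl
    · rfl

theorem resetAutomaton_init_ne_on (D : DistAlphabet P A) (l : P) (R₁ R₂ : Set A) :
    (resetAutomaton D l R₁ R₂).init l ≠ resetAutomaton.on D l R₁ R₂ := by
  simp [resetAutomaton, resetAutomaton.on]

theorem resetAutomaton_isU2 {l : P} {R₁ R₂ : Set A} (h₁ : R₁ ⊆ D.sub l) (h₂ : R₂ ⊆ D.sub l)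
    (hd : Disjoint R₁ R₂) : (resetAutomaton D l R₁ R₂).IsU2 l := by
  refine ⟨fun i hi => ?_, _, _, resetAutomaton_init_ne_on D l R₁ R₂, ?_, R₁, R₂, h₁, h₂, hd,
    resetAutomaton_Δ h₁ h₂ hd⟩
  · refine Nat.card_eq_one_iff_unique.2 ⟨⟨?_⟩, ⟨(resetAutomaton D l R₁ R₂).init i⟩⟩
    rintro ⟨x, hx⟩ ⟨y, hy⟩
    have : x = y := (hx hi).trans (hy hi).symm
    subst this
    rfl
  · rintro ⟨x, hx⟩
    cases x
    · exact Or.inl rfl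
    · exact Or.inr rfl

namespace GlobalCascade

variable {G G' : Type u}

/-- `π` sends the runs of the cascade `B'` to runs of `B`; so `B'` computes at least as much
information as `B`. -/
def Refines (B' : GlobalCascade D G') (B : GlobalCascade D G) (π : G' → G) : Prop :=
  ∀ (t : Trace D) (ρ : LowerSet t.E → G'), B'.IsRun t ρ → B.IsRun t (fun c => π (ρ c))

theorem Refines.refl (B : GlobalCascade D G) : B.Refines B id := fun _ _ h => h

theorem Refines.trans {G'' : Type u} {B'' : GlobalCascade D G''} {B' : GlobalCascade D G'}
    {B : GlobalCascade D G} {π' : G'' → G'} {π : G' → G} (h' : B''.Refines B' π')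
    (h : B'.Refines B π) : B''.Refines B (π ∘ π') := fun t ρ hρ => h t _ (h' t ρ hρ)

/-- The truth of `α` at an event `e` is the value of `d` at the letter of `e` and the global state
of `B` at the strict past of `e`. -/
def Determines (B : GlobalCascade D G) (α : EventFormula P A) (d : A → G → Prop) : Prop :=
  ∀ (t : Trace D) (ρ : LowerSet t.E → G), B.IsRun t ρ →
    ∀ e, α.Sat t e ↔ d (t.lab e) (ρ (LowerSet.Iio e))

theorem Determines.of_refines {B' : GlobalCascade D G'} {B : GlobalCascade D G} {π : G' → G}
    {α : EventFormula P A} {d : A → G → Prop} (h : B.Determines α d) (hπ : B'.Refines B π) :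
    B'.Determines α (fun a g => d a (π g)) := fun t ρ hρ e => h t _ (hπ t ρ hρ) e

/-- The truth of `β` in a trace is decided by whether the final global state of `B` is in `F`. -/
def Decides (B : GlobalCascade D G) (β : TraceFormula P A) (F : Set G) : Prop :=
  ∀ (t : Trace D) (ρ : LowerSet t.E → G), B.IsRun t ρ → (β.Sat t ↔ ρ ⊤ ∈ F)

theorem Decides.of_refines {B' : GlobalCascade D G'} {B : GlobalCascade D G} {π : G' → G}
    {β : TraceFormula P A} {F : Set G} (h : B.Decides β F) (hπ : B'.Refines B π) :
    B'.Decides β (π ⁻¹' F) := fun t ρ hρ => h t _ (hπ t ρ hρ)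

/-- A cascade can be prolonged by a reset automaton that reads its global states. -/
theorem exists_refines_resetOn {B : GlobalCascade D G} (hB : B.IsU2Cascade) (l : P)
    {R₁ R₂ : Set (A × G)} (h₁ : R₁ ⊆ (D.extend G).sub l) (h₂ : R₂ ⊆ (D.extend G).sub l)
    (hd : Disjoint R₁ R₂) :
    ∃ (G' : Type u) (B' : GlobalCascade D G') (π : G' → G) (F : Set G'), B'.IsU2Cascade ∧
      B'.Refines B π ∧ ∀ (t : Trace D) (ρ : LowerSet t.E → G'), B'.IsRun t ρ →
        ∀ c, ρ c ∈ F ↔ ResetOn (t.relabel fun c => π (ρ c)) R₁ R₂ False c := by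
  refine ⟨_, .prod B (.base (resetAutomaton (D.extend G) l R₁ R₂)), Prod.fst,
    {g | g.2 l = resetAutomaton.on (D.extend G) l R₁ R₂},
    ⟨hB, l, resetAutomaton_isU2 h₁ h₂ hd⟩, fun t ρ hρ => hρ.1, fun t ρ hρ c => ?_⟩
  have := AsyncAutomaton.IsRun.state_eq_iff_resetOn (t := t.relabel fun c => (ρ c).1) hρ.2
    (resetAutomaton_init_ne_on (D.extend G) l R₁ R₂) h₁ h₂ (resetAutomaton_Δ h₁ h₂ hd) c
  rwa [eq_false (resetAutomaton_init_ne_on (D.extend G) l R₁ R₂)] at this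

theorem exists_refines_lastSat {B : GlobalCascade D G} (hB : B.IsU2Cascade) (l : P)
    {α : EventFormula P A} {d : A → G → Prop} (hd : B.Determines α d) :
    ∃ (G' : Type u) (B' : GlobalCascade D G') (π : G' → G) (F : Set G'), B'.IsU2Cascade ∧
      B'.Refines B π ∧ ∀ (t : Trace D) (ρ : LowerSet t.E → G'), B'.IsRun t ρ →
        ∀ c, ρ c ∈ F ↔ LastSat t l c α := by
  obtain ⟨G', B', π, F, hB', hπ, hF⟩ := exists_refines_resetOn hB l
    (R₁ := {x | x.1 ∈ D.sub l ∧ ¬ d x.1 x.2}) (R₂ := {x | x.1 ∈ D.sub l ∧ d x.1 x.2})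
    (fun x hx => hx.1) (fun x hx => hx.1) (Set.disjoint_left.2 fun x hx hx' => hx.2 hx'.2)
  refine ⟨G', B', π, F, hB', hπ, fun t ρ hρ c => ?_⟩
  rw [hF t ρ hρ c, lastSat_iff_exists]
  have := hd t _ (hπ t ρ hρ)
  simp only [ResetOn, Trace.relabel, Set.mem_ofPred_eq, false_and, or_false, ← this, not_and,
    not_not, and_assoc]
  exact exists_congr fun f => and_congr_right fun _ => and_congr_right fun _ =>
    and_congr_right fun _ => forall_congr' fun g => forall_congr' fun _ => forall_comm

theorem exists_refines_since {B : GlobalCascade D G} (hB : B.IsU2Cascade) (l : P)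
    {α β : EventFormula P A} {d d' : A → G → Prop} (hd : B.Determines α d)
    (hd' : B.Determines β d') :
    ∃ (G' : Type u) (B' : GlobalCascade D G') (π : G' → G) (d' : A → G' → Prop),
      B'.IsU2Cascade ∧ B'.Refines B π ∧ B'.Determines (.since l α β) d' := by
  obtain ⟨G', B', π, F, hB', hπ, hF⟩ := exists_refines_resetOn hB l
    (R₁ := {x | x.1 ∈ D.sub l ∧ ¬ (d' x.1 x.2 ∨ d x.1 x.2)})
    (R₂ := {x | x.1 ∈ D.sub l ∧ d' x.1 x.2})
    (fun x hx => hx.1) (fun x hx => hx.1)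
    (Set.disjoint_left.2 fun x hx hx' => hx.2 (Or.inl hx'.2))
  refine ⟨G', B', π, fun a g => a ∈ D.sub l ∧ g ∈ F, hB', hπ, fun t ρ hρ e => ?_⟩
  beta_reduce
  rw [hF t ρ hρ, EventFormula.sat_since_iff]
  simp only [ResetOn, Trace.relabel, Set.mem_ofPred_eq, false_and, or_false, ← hd t _ (hπ t ρ hρ),
    ← hd' t _ (hπ t ρ hρ), not_and, not_not, and_assoc]
  exact and_congr_right fun _ => exists_congr fun f => and_congr_right fun _ =>
    and_congr_right fun _ => and_congr_right fun _ => forall_congr' fun g =>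
    forall_congr' fun _ => forall_comm

theorem exists_refines_determines (α : EventFormula P A) :
    ∀ {G : Type u} {B : GlobalCascade D G}, B.IsU2Cascade →
      ∃ (G' : Type u) (B' : GlobalCascade D G') (π : G' → G) (d : A → G' → Prop),
        B'.IsU2Cascade ∧ B'.Refines B π ∧ B'.Determines α d := by
  induction α with
  | letter a =>
    exact fun {G B} hB => ⟨G, B, id, fun b _ => b = a, hB, .refl B, fun t ρ _ e => Iff.rfl⟩
  | neg α ih =>
    intro G B hB
    obtain ⟨G', B', π, d, hB', hπ, hd⟩ := ih hB
    exact ⟨G', B', π, fun a g => ¬ d a g, hB', hπ, fun t ρ hρ e => not_congr (hd t ρ hρ e)⟩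
  | or α β ihα ihβ =>
    intro G B hB
    obtain ⟨G₁, B₁, π₁, d₁, hB₁, hπ₁, hd₁⟩ := ihα hB
    obtain ⟨G₂, B₂, π₂, d₂, hB₂, hπ₂, hd₂⟩ := ihβ hB₁
    exact ⟨G₂, B₂, _, fun a g => d₁ a (π₂ g) ∨ d₂ a g, hB₂, hπ₂.trans hπ₁, fun t ρ hρ e =>
      or_congr (hd₁.of_refines hπ₂ t ρ hρ e) (hd₂ t ρ hρ e)⟩
  | Y l α ih =>
    intro G B hB
    obtain ⟨G₁, B₁, π₁, d₁, hB₁, hπ₁, hd₁⟩ := ih hB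
    obtain ⟨G₂, B₂, π₂, F, hB₂, hπ₂, hF⟩ := exists_refines_lastSat hB₁ l hd₁
    exact ⟨G₂, B₂, _, fun _ g => g ∈ F, hB₂, hπ₂.trans hπ₁, fun t ρ hρ e =>
      (EventFormula.sat_Y_iff t l α e).trans (hF t ρ hρ _).symm⟩
  | since l α β ihα ihβ =>
    intro G B hB
    obtain ⟨G₁, B₁, π₁, d₁, hB₁, hπ₁, hd₁⟩ := ihα hB
    obtain ⟨G₂, B₂, π₂, d₂, hB₂, hπ₂, hd₂⟩ := ihβ hB₁
    obtain ⟨G₃, B₃, π₃, d₃, hB₃, hπ₃, hd₃⟩ :=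
      exists_refines_since hB₂ l (hd₁.of_refines hπ₂) hd₂
    exact ⟨G₃, B₃, _, d₃, hB₃, hπ₃.trans (hπ₂.trans hπ₁), hd₃⟩

theorem exists_refines_decides (β : TraceFormula P A) :
    ∀ {G : Type u} {B : GlobalCascade D G}, B.IsU2Cascade →
      ∃ (G' : Type u) (B' : GlobalCascade D G') (π : G' → G) (F : Set G'),
        B'.IsU2Cascade ∧ B'.Refines B π ∧ B'.Decides β F := by
  induction β with
  | ex l α =>
    intro G B hB
    obtain ⟨G₁, B₁, π₁, d₁, hB₁, hπ₁, hd₁⟩ := exists_refines_determines α hB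
    obtain ⟨G₂, B₂, π₂, F, hB₂, hπ₂, hF⟩ := exists_refines_lastSat hB₁ l hd₁
    exact ⟨G₂, B₂, _, F, hB₂, hπ₂.trans hπ₁, fun t ρ hρ =>
      (TraceFormula.sat_ex_iff t l α).trans (hF t ρ hρ _).symm⟩
  | neg β ih =>
    intro G B hB
    obtain ⟨G', B', π, F, hB', hπ, hF⟩ := ih hB
    exact ⟨G', B', π, Fᶜ, hB', hπ, fun t ρ hρ => not_congr (hF t ρ hρ)⟩
  | or β γ ihβ ihγ =>
    intro G B hB
    obtain ⟨G₁, B₁, π₁, F₁, hB₁, hπ₁, hF₁⟩ := ihβ hB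
    obtain ⟨G₂, B₂, π₂, F₂, hB₂, hπ₂, hF₂⟩ := ihγ hB₁
    exact ⟨G₂, B₂, _, π₂ ⁻¹' F₁ ∪ F₂, hB₂, hπ₂.trans hπ₁, fun t ρ hρ =>
      or_congr (hF₁.of_refines hπ₂ t ρ hρ) (hF₂ t ρ hρ)⟩

/-- The set of final states with which `B` accepts a language is the one with which it decides a
formula defining the language. -/
theorem Decides.accepts {B : GlobalCascade D G} (hB : B.IsU2Cascade) {β : TraceFormula P A}
    {F : Set G} (hF : B.Decides β F) {L : Set (TR D)} (hβ : β.Defines L) : B.Accepts L := by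
  refine ⟨F, fun t => (hβ t).trans ⟨fun h => ?_, ?_⟩⟩
  · obtain ⟨ρ, hρ⟩ := hB.exists_isRun t
    exact ⟨ρ, hρ, (hF t ρ hρ).1 h⟩
  · rintro ⟨ρ, hρ, h⟩
    exact (hF t ρ hρ).2 h

end GlobalCascade

/-! ### Finite disjunctions and substitution of letters -/

theorem EventFormula.exists_sat_iff_lab_mem [Finite A] [Nonempty A] (R : Set A) :
    ∃ α : EventFormula P A, ∀ {D : DistAlphabet P A} (t : Trace D) (e : t.E),
      α.Sat t e ↔ t.lab e ∈ R := by
  induction R, R.toFinite using Set.Finite.induction_on with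
  | empty =>
    have a : A := Classical.arbitrary A
    exact ⟨.neg (.or (.letter a) (.neg (.letter a))), fun t e => by
      simp only [EventFormula.Sat, Set.mem_empty_iff_false, iff_false, not_not]
      exact em _⟩
  | @insert a R _ _ ih =>
    obtain ⟨α, hα⟩ := ih
    exact ⟨.or (.letter a) α, fun t e => by
      simp only [EventFormula.Sat, Set.mem_insert_iff, hα]⟩

theorem TraceFormula.exists_sat_iff_exists_mem [Nonempty P] [Nonempty A] {G : Type u} [Finite G]
    (F : Set G) (β : G → TraceFormula P A) :
    ∃ γ : TraceFormula P A, ∀ {D : DistAlphabet P A} (t : Trace D),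
      γ.Sat t ↔ ∃ g ∈ F, (β g).Sat t := by
  induction F, F.toFinite using Set.Finite.induction_on with
  | empty =>
    have γ : TraceFormula P A :=
      .ex (Classical.arbitrary P) (.letter (Classical.arbitrary A))
    exact ⟨.neg (.or γ (.neg γ)), fun t => by
      simp only [TraceFormula.Sat, Set.mem_empty_iff_false, false_and, exists_false, iff_false,
        not_not]
      exact em _⟩
  | @insert g F _ _ ih =>
    obtain ⟨γ, hγ⟩ := ih
    exact ⟨.or (β g) γ, fun t => by
      simp only [TraceFormula.Sat, Set.mem_insert_iff, hγ, exists_eq_or_imp]⟩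

/-- Substitution of event formulas for the letters of an event formula. -/
def EventFormula.subst {A' : Type u} (σ : A' → EventFormula P A) :
    EventFormula P A' → EventFormula P A
  | .letter a => σ a
  | .neg α => .neg (α.subst σ)
  | .or α β => .or (α.subst σ) (β.subst σ)
  | .Y i α => .Y i (α.subst σ)
  | .since i α β => .since i (α.subst σ) (β.subst σ)

/-- Substitution of event formulas for the letters of a trace formula. -/
def TraceFormula.subst {A' : Type u} (σ : A' → EventFormula P A) :
    TraceFormula P A' → TraceFormula P A
  | .ex i α => .ex i (α.subst σ)
  | .neg β => .neg (β.subst σ)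
  | .or β γ => .or (β.subst σ) (γ.subst σ)

theorem EventFormula.sat_subst_iff {G : Type u} {t : Trace D} {ρ : LowerSet t.E → G}
    {σ : A × G → EventFormula P A}
    (hσ : ∀ x e, (σ x).Sat t e ↔ (t.lab e, ρ (LowerSet.Iio e)) = x)
    (α : EventFormula P (A × G)) :
    ∀ e : t.E, (α.subst σ).Sat t e ↔ α.Sat (t.relabel ρ) e := by
  induction α with
  | letter x => exact fun e => hσ x e
  | neg α ih => exact fun e => not_congr (ih e)
  | or α β ihα ihβ => exact fun e => or_congr (ihα e) (ihβ e)
  | Y i α ih => exact fun e => exists_congr fun f => and_congr_right fun _ => ih f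
  | since i α β ihα ihβ =>
    exact fun e => and_congr_right fun _ => exists_congr fun f => and_congr_right fun _ =>
      and_congr_right fun _ => and_congr (ihβ f) <| forall_congr' fun g => forall_congr' fun _ =>
      forall_congr' fun _ => forall_congr' fun _ => ihα g

theorem TraceFormula.sat_subst_iff {G : Type u} {t : Trace D} {ρ : LowerSet t.E → G}
    {σ : A × G → EventFormula P A}
    (hσ : ∀ x e, (σ x).Sat t e ↔ (t.lab e, ρ (LowerSet.Iio e)) = x)
    (β : TraceFormula P (A × G)) : (β.subst σ).Sat t ↔ β.Sat (t.relabel ρ) := by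
  induction β with
  | ex i α => exact exists_congr fun e => and_congr_right fun _ =>
      EventFormula.sat_subst_iff hσ α e
  | neg β ih => exact not_congr ih
  | or β γ ihβ ihγ => exact or_congr ihβ ihγ

/-! ### From cascades to formulas -/

/-- `α g` and `β g` express that the global state of `B` is `g`, at the strict past of the current
event and at the end of the trace respectively. -/
def GlobalCascade.IsStateFormulas {G : Type u} (B : GlobalCascade D G)
    (α : G → EventFormula P A) (β : G → TraceFormula P A) : Prop :=
  ∀ (t : Trace D) (ρ : LowerSet t.E → G), B.IsRun t ρ → ∀ g,
    (∀ e, (α g).Sat t e ↔ ρ (LowerSet.Iio e) = g) ∧ ((β g).Sat t ↔ ρ ⊤ = g)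

/-- `ResetOn` is expressed by formulas about the last `l`-event of the configuration. -/
theorem exists_lastSat_iff_resetOn [Finite A] [Nonempty A] (D : DistAlphabet P A) {l : P}
    {R₁ R₂ : Set A} (h₁ : R₁ ⊆ D.sub l) (h₂ : R₂ ⊆ D.sub l) (b : Prop) :
    ∃ α β : EventFormula P A, ∀ (t : Trace D) (c : LowerSet t.E),
      (LastSat t l c α ∨ (b ∧ ¬ LastSat t l c β)) ↔ ResetOn t R₁ R₂ b c := by
  obtain ⟨α₁, hα₁⟩ := EventFormula.exists_sat_iff_lab_mem (P := P) R₁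
  obtain ⟨α₂, hα₂⟩ := EventFormula.exists_sat_iff_lab_mem (P := P) R₂
  obtain ⟨τ, hτ⟩ := EventFormula.exists_sat_iff_lab_mem (P := P) (Set.univ : Set A)
  refine ⟨.sinceIncl l (.neg α₁) α₂, .sinceIncl l τ α₁, fun t c => ?_⟩
  simp only [lastSat_sinceIncl_iff, EventFormula.Sat, hα₁, hα₂, hτ, Set.mem_univ, implies_true,
    and_true, ResetOn]
  refine or_congr (exists_congr fun f => and_congr_right fun _ => ?_)
    (and_congr_right fun _ => ?_)
  · exact ⟨fun ⟨_, h, h'⟩ => ⟨h, fun g hg hfg hR => h' g hg (h₁ hR) hfg hR⟩,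
      fun ⟨h, h'⟩ => ⟨h₂ h, h, fun g hg _ hfg => h' g hg hfg⟩⟩
  · exact ⟨fun h g hg hR => h ⟨g, hg, h₁ hR, hR⟩, fun h ⟨g, hg, _, hR⟩ => h g hg hR⟩

open Classical in
theorem AsyncAutomaton.IsU2.exists_stateFormulas [Finite A] [Nonempty A]
    {M : AsyncAutomaton D} {l : P} (hM : M.IsU2 l) :
    ∃ α β, (GlobalCascade.base M).IsStateFormulas α β := by
  obtain ⟨hcard, q₁, q₂, hq, hall, R₁, R₂, h₁, h₂, -, hΔ⟩ := hM
  have hsub : ∀ i, i ≠ l → Subsingleton (M.S i) := fun i hi =>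
    (Nat.card_eq_one_iff_unique.1 (hcard i hi)).1
  have hext : ∀ s s' : M.Global, s = s' ↔ (s l = q₂ ↔ s' l = q₂) := by
    refine fun s s' => ⟨fun h => h ▸ Iff.rfl, fun h => funext fun i => ?_⟩
    by_cases hi : i = l
    · subst hi
      rcases hall (s i) with h' | h' <;> rcases hall (s' i) with h'' | h'' <;>
        simp_all [eq_comm]
    · exact (hsub i hi).elim _ _
  obtain ⟨α, β, hαβ⟩ := exists_lastSat_iff_resetOn D h₁ h₂ (M.init l = q₂)
  let φ : EventFormula P A :=
    if M.init l = q₂ then .or (.Y l α) (.neg (.Y l β)) else .Y l α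
  let ψ : TraceFormula P A :=
    if M.init l = q₂ then .or (.ex l α) (.neg (.ex l β)) else .ex l α
  refine ⟨fun g => if g l = q₂ then φ else .neg φ, fun g => if g l = q₂ then ψ else .neg ψ,
    fun t ρ hρ g => ?_⟩
  have hstate := fun c => (hαβ t c).trans
    (AsyncAutomaton.IsRun.state_eq_iff_resetOn hρ hq h₁ h₂ hΔ c).symm
  have hφ : ∀ e, φ.Sat t e ↔ ρ (LowerSet.Iio e) l = q₂ := fun e => by
    rw [← hstate]
    by_cases h : M.init l = q₂ <;>
      simp [φ, h, EventFormula.Sat, ← EventFormula.sat_Y_iff]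
  have hψ : ψ.Sat t ↔ ρ ⊤ l = q₂ := by
    rw [← hstate, ← TraceFormula.sat_ex_iff, ← TraceFormula.sat_ex_iff]
    by_cases h : M.init l = q₂ <;> simp [ψ, h, TraceFormula.Sat]
  refine ⟨fun e => ?_, ?_⟩
  · rw [hext, ← hφ]
    by_cases h : g l = q₂ <;> simp [h, EventFormula.Sat]
  · rw [hext, ← hψ]
    by_cases h : g l = q₂ <;> simp [h, TraceFormula.Sat]

theorem GlobalCascade.finite_global [Finite P] {G : Type u} (B : GlobalCascade D G) :
    Finite G := by
  induction B with
  | base M =>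
    have := M.finite
    infer_instance
  | prod B₁ B₂ ih₁ ih₂ => infer_instance

theorem GlobalCascade.nonempty_global {G : Type u} (B : GlobalCascade D G) : Nonempty G := by
  induction B with
  | base M => exact ⟨M.init⟩
  | prod B₁ B₂ ih₁ ih₂ => infer_instance

theorem GlobalCascade.exists_stateFormulas [Finite P] [Finite A] [Nonempty A] {G : Type u}
    (B : GlobalCascade D G) (hB : B.IsU2Cascade) : ∃ α β, B.IsStateFormulas α β := by
  -- The alphabet changes from factor to factor, so its finiteness belongs to the induction.
  rename_i hA hA'
  revert hA hA'
  induction B with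
  | base M =>
    intro _ _
    obtain ⟨l, hl⟩ := hB
    exact hl.exists_stateFormulas
  | prod B₁ B₂ ih₁ ih₂ =>
    intro _ _
    have := B₁.finite_global
    have := B₁.nonempty_global
    obtain ⟨α₁, β₁, h₁⟩ := ih₁ hB.1
    obtain ⟨α₂, β₂, h₂⟩ := ih₂ hB.2
    let σ := fun x : _ × _ => EventFormula.neg (.or (.neg (.letter x.1)) (.neg (α₁ x.2)))
    refine ⟨fun g => .neg (.or (.neg (α₁ g.1)) (.neg ((α₂ g.2).subst σ))),
      fun g => .neg (.or (.neg (β₁ g.1)) (.neg ((β₂ g.2).subst σ))), fun t ρ hρ g => ?_⟩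
    have hρ₁ := h₁ t _ hρ.1
    have hρ₂ := h₂ (t.relabel fun c => (ρ c).1) (fun c => (ρ c).2) hρ.2
    have hσ : ∀ x e, (σ x).Sat t e ↔ (t.lab e, (ρ (LowerSet.Iio e)).1) = x := fun x e => by
      simp only [σ, EventFormula.Sat, not_or, not_not, (hρ₁ _).1, Prod.ext_iff]
    refine ⟨fun e => ?_, ?_⟩
    · simp only [EventFormula.Sat, not_or, not_not, (hρ₁ _).1, Prod.ext_iff,
        EventFormula.sat_subst_iff (ρ := fun c => (ρ c).1) hσ]
      exact and_congr_right fun _ => (hρ₂ g.2).1 e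
    · simp only [TraceFormula.Sat, not_or, not_not, (hρ₁ _).2, Prod.ext_iff,
        TraceFormula.sat_subst_iff (ρ := fun c => (ρ c).1) hσ]
      exact and_congr_right fun _ => (hρ₂ g.2).2

end TraceCascade

theorem mainTheorem4 {P A : Type u} [Finite P] [Finite A] [Nonempty A]
    (D : TraceCascade.DistAlphabet P A) (L : Set (TraceCascade.TR D)) :
    (∃ β : TraceCascade.TraceFormula P A, β.Defines L) ↔
      ∃ (G : Type u) (B : TraceCascade.GlobalCascade D G), B.IsU2Cascade ∧ B.Accepts L := by
  obtain ⟨l, -⟩ := D.cover (Classical.arbitrary A)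
  constructor
  · rintro ⟨β, hβ⟩
    -- Prolong a cascade that never leaves its initial state.
    obtain ⟨G, B, -, F, hB, -, hF⟩ := TraceCascade.GlobalCascade.exists_refines_decides β
      (B := .base (TraceCascade.resetAutomaton D l ∅ ∅))
      ⟨l, TraceCascade.resetAutomaton_isU2 (Set.empty_subset _) (Set.empty_subset _)
        disjoint_bot_left⟩
    exact ⟨G, B, hB, hF.accepts hB hβ⟩
  · rintro ⟨G, B, hB, F, hF⟩
    obtain ⟨_, β, hβ⟩ := B.exists_stateFormulas hB
    have := B.finite_global
    have : Nonempty P := ⟨l⟩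
    obtain ⟨γ, hγ⟩ := TraceCascade.TraceFormula.exists_sat_iff_exists_mem F β
    refine ⟨γ, fun t => (hF t).trans ((hγ t).trans ⟨?_, ?_⟩).symm⟩
    · rintro ⟨g, hg, h⟩
      obtain ⟨ρ, hρ⟩ := hB.exists_isRun t
      exact ⟨ρ, hρ, ((hβ t ρ hρ g).2.1 h).symm ▸ hg⟩
    · rintro ⟨ρ, hρ, h⟩
      exact ⟨ρ ⊤, h, (hβ t ρ hρ _).2.2 rfl⟩
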